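/- Let $k,l\ge 1$ be fixed integers, let $\sigma_a,\sigma_z>0$, and write $[m]=\{1,\dots,m\}$. For $m\ge k$ let $\mathbf S=(S_1,\dots,S_k)$ be drawn uniformly at random from $[m]$ without replacement. For a matrix $W\in\mathbb R^{k\times l}$ with all entries nonzero, let $X=X(W,\mathbf S)\in\mathbb R^{m\times l}$ be the matrix whose $S_j$-th row is the $j$-th row of $W$ for $j\in[k]$ and whose other rows vanish, and let $\operatorname{supp}(X)=\{S_1,\dots,S_k\}$ be the set of indices of its nonzero rows. One observes $$Y=AX+Z\in\mathbb R^{n_m\times l},$$ where $n_m\ge 1$, the entries of $A\in\mathbb R^{n_m\times m}$ are i.i.d. $\mathcal N(0,\sigma_a^2)$, the entries of $Z\in\mathbb R^{n_m\times l}$ are i.i.d. $\mathcal N(0,\sigma_z^2)$, and $\mathbf S$, $A$, $Z$ are independent. A support recovery map $d^{(m)}$ assigns to the (known) measurement matrix $A$ and the observation $Y$ a subset $d^{(m)}(A,Y)\subseteq[m]$, measurably in $(A,Y)$; it does not know $W$, $\mathbf S$ or $Z$. Let $$c(W)=\min_{\emptyset\ne T\subseteq[k]}\ \frac1{2|T|}\log\det\Bigl(I+\frac{\sigma_a^2}{\sigma_z^2}W_T^{\top}W_T\Bigr),$$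 where $W_T$ is the submatrix of $W$ formed by the rows indexed by $T$ and $\log$ is the natural logarithm. Then for every sequence $(n_m)_{m\ge k}$ of positive integers there is a sequence of support recovery maps $(d^{(m)})_{m\ge k}$, not depending on $W$, such that for every $W\in\mathbb R^{k\times l}$ with all entries nonzero and $$\limsup_{m\to\infty}\frac{\log m}{n_m}<c(W)$$ the average probability of error, taken over $\mathbf S$, $A$ and $Z$, satisfies $$\lim_{m\to\infty}\mathbb P\bigl\{d^{(m)}(A,Y)\ne\operatorname{supp}(X(W,\mathbf S))\bigr\}=0 .$$ In particular, for each fixed such $W$ there is a sequence of support recovery maps with average error probability tending to $0$. -/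

import Mathlib

open MeasureTheory ProbabilityTheory Filter Topology

namespace SupportRecovery

noncomputable section

/-- Matrices carry the product (Borel) σ-algebra of their entries. -/
instance instMeasurableSpaceMatrix {p q : ℕ} : MeasurableSpace (Matrix (Fin p) (Fin q) ℝ) :=
  inferInstanceAs (MeasurableSpace (Fin p → Fin q → ℝ))

/-- The rate threshold
`c(W) = min_T (1 / (2|T|)) log det (I + (σa² / σz²) W_Tᵀ W_T)`,
where `T` runs over the nonempty subsets of the row index set and `W_T` is the submatrix
formed by the rows of `W` indexed by `T` (the infimum is over a finite set). -/
def threshold {k l : ℕ} (σa σz : ℝ) (W : Matrix (Fin k) (Fin l) ℝ) : ℝ :=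
  ⨅ T : {T : Finset (Fin k) // T.Nonempty},
    1 / (2 * (T.1.card : ℝ)) *
      Real.log (Matrix.det
        (1 + (σa ^ 2 / σz ^ 2) •
          ((W.submatrix (fun i : T.1 => (i : Fin k)) id).transpose *
            W.submatrix (fun i : T.1 => (i : Fin k)) id)))

/-- The signal `X(W, S)`: row `S j` of `X` is row `j` of `W`, all other rows vanish.
(For injective `S`, at most one summand is nonzero.) -/
def signal {k l m : ℕ} (W : Matrix (Fin k) (Fin l) ℝ) (S : Fin k → Fin m) :
    Matrix (Fin m) (Fin l) ℝ :=
  Matrix.of fun s i => ∑ j : Fin k, if s = S j then W j i else 0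

/-- The support of a matrix: the set of indices of its nonzero rows. -/
def rowSupport {m l : ℕ} (X : Matrix (Fin m) (Fin l) ℝ) : Set (Fin m) :=
  {s | ∃ i, X s i ≠ 0}

/-- The law of a `p × q` matrix with i.i.d. `N(0, σ²)` entries. -/
def gaussianMatrix (p q : ℕ) (σ : ℝ) : Measure (Matrix (Fin p) (Fin q) ℝ) :=
  (Measure.pi fun _ : Fin p => Measure.pi fun _ : Fin q =>
    gaussianReal 0 (Real.toNNReal (σ ^ 2)) : Measure (Fin p → Fin q → ℝ))

/-- The law of `S = (S_1, …, S_k)` drawn uniformly from `[m]` without replacement. -/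
def locationLaw (k m : ℕ) : Measure (Fin k → Fin m) :=
  uniformOn {S : Fin k → Fin m | Function.Injective S}

/-- The joint law of the independent triple `(S, A, Z)`: locations, `n × m` measurement matrix,
`n × l` noise matrix. -/
def modelLaw (k l m n : ℕ) (σa σz : ℝ) :
    Measure ((Fin k → Fin m) × Matrix (Fin n) (Fin m) ℝ × Matrix (Fin n) (Fin l) ℝ) :=
  (locationLaw k m).prod ((gaussianMatrix n m σa).prod (gaussianMatrix n l σz))

/-- The noisy measurement `Y = A X(W, S) + Z`. -/
def measurement {k l m n : ℕ} (W : Matrix (Fin k) (Fin l) ℝ)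
    (ω : (Fin k → Fin m) × Matrix (Fin n) (Fin m) ℝ × Matrix (Fin n) (Fin l) ℝ) :
    Matrix (Fin n) (Fin l) ℝ :=
  ω.2.1 * signal W ω.1 + ω.2.2

/-- The average probability of error `P{d(Y) ≠ supp X(W, S)}`, over `S`, `A` and `Z`. The support
recovery map is applied to `Y` and, like the receiver of the model, knows the realization of the
measurement matrix `A`. -/
def errorProb {k l m n : ℕ} (σa σz : ℝ) (W : Matrix (Fin k) (Fin l) ℝ)
    (d : Matrix (Fin n) (Fin m) ℝ → Matrix (Fin n) (Fin l) ℝ → Set (Fin m)) : ℝ :=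
  (modelLaw k l m n σa σz).real {ω | d ω.2.1 (measurement W ω) ≠ rowSupport (signal W ω.1)}

end

end SupportRecovery

/-!
The receiver does not know `W`, so it tests the possible locations together with the first `n`
terms `w` of a sequence of candidate rows that is dense in `ℝ^{k × l}`. It accepts the locations
`S'` for `w` when, for every nonempty `T ⊆ [k]`, the information density between the coefficients
at the locations `S'_T` and the measurement, summed over the `n` rows and computed as if `w` were
the signal, exceeds `|T| log m + √n`.

False acceptance. If `T` is the set of indices whose locations under `S'` lie outside the support,
the coefficients at `S'_T` are independent of the measurement, and integrating them out of the
exponential of the information density gives `1`, since each of these Gaussian integrals is a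
rank-one update of a covariance matrix. This holds whatever `W` and `w` are. By Markov's
inequality, `S'` is accepted for `w` with probability at most `m^{-|T|} e^{-√n}`; as
`∑_T k^{k - |T|} m^{|T|} m^{-|T|} = (k + 1)^k`, summing over the locations `S'` and over the `n`
candidates leaves at most `n (k + 1)^k e^{-√n}`.

True acceptance. The mean information density per row is continuous in `w`, and at `w = W` it is
`½ log det (I + (σa² / σz²) W_Tᵀ W_T) ≥ |T| c(W)`. A candidate close enough to `W` therefore has a
mean that exceeds `|T| log m / n` by a margin, and by Chebyshev's inequality it is accepted at the
true locations with probability tending to `1`.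
-/

namespace SupportRecovery

open scoped ENNReal NNReal Matrix

/-! ### Gaussian integrals and rank-one updates -/

lemma gaussianPDFReal_mul_exp_quadratic {v : ℝ≥0} (hv : v ≠ 0) (b : ℝ) (c : ℝ≥0) (x : ℝ) :
    gaussianPDFReal 0 v x * Real.exp (b * x - c * x ^ 2 / 2) =
      Real.exp (v * b ^ 2 / (2 * (1 + v * c)) - Real.log (1 + v * c) / 2) *
        gaussianPDFReal (v * b / (1 + v * c)) (v / (1 + v * c)) x := by
  have : (0 : ℝ) < v := by positivity
  set t : ℝ := 1 + v * c with ht_def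
  have ht : 0 < t := by positivity
  have hsqrt : √(2 * Real.pi * v) = √t * √(2 * Real.pi * (v / t)) := by
    rw [← Real.sqrt_mul ht.le]
    congr 1
    field_simp
  have hlog : Real.exp (Real.log t / 2) = √t := by
    rw [← Real.log_sqrt ht.le, Real.exp_log (Real.sqrt_pos.2 ht)]
  have hsquare : -(x - 0) ^ 2 / (2 * v) + (b * x - c * x ^ 2 / 2) =
      v * b ^ 2 / (2 * t) + -(x - v * b / t) ^ 2 / (2 * (v / t)) := by
    have hc : (c : ℝ) = (t - 1) / v := by rw [ht_def]; field_simp; ring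
    rw [hc]
    field_simp
    ring
  simp only [gaussianPDFReal, NNReal.coe_div, NNReal.coe_add, NNReal.coe_one, NNReal.coe_mul,
    ← ht_def]
  rw [mul_assoc, ← Real.exp_add, hsquare, Real.exp_add, Real.exp_sub, hlog, hsqrt]
  field_simp

lemma lintegral_exp_quadratic_gaussianReal (v : ℝ≥0) (b : ℝ) {c : ℝ} (hc : 0 ≤ c) :
    ∫⁻ x, ENNReal.ofReal (Real.exp (b * x - c * x ^ 2 / 2)) ∂gaussianReal 0 v =
      ENNReal.ofReal (Real.exp (v * b ^ 2 / (2 * (1 + v * c)) - Real.log (1 + v * c) / 2)) := by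
  lift c to ℝ≥0 using hc
  rcases eq_or_ne v 0 with rfl | hv
  · simp
  have hv' : v / (1 + v * c) ≠ 0 := by positivity
  rw [gaussianReal_of_var_ne_zero _ hv,
    lintegral_withDensity_eq_lintegral_mul _ (measurable_gaussianPDF _ _) (by fun_prop)]
  simp only [Pi.mul_apply, gaussianPDF, ← ENNReal.ofReal_mul (gaussianPDFReal_nonneg _ _ _),
    gaussianPDFReal_mul_exp_quadratic hv, ENNReal.ofReal_mul (Real.exp_pos _).le]
  rw [lintegral_const_mul _ (by fun_prop),
    lintegral_gaussianPDFReal_eq_one _ hv', mul_one]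

section RankOneUpdates

variable {ι κ σ : Type*}

lemma posDef_add_smul_sum_vecMulVec [Finite ι] {M : Matrix ι ι ℝ} (hM : M.PosDef) (v : ℝ≥0)
    (w : κ → ι → ℝ) (T : Finset κ) : (M + (v : ℝ) • ∑ j ∈ T, Matrix.vecMulVec (w j) (w j)).PosDef :=
  hM.add_posSemidef <| .smul (Matrix.posSemidef_sum _ fun j _ => by
    simpa using Matrix.posSemidef_vecMulVec_self_star (w j)) v.coe_nonneg

variable [Fintype ι] [DecidableEq ι]

lemma det_add_vecMulVec {R : Type*} [CommRing R] {M : Matrix ι ι R} (hM : IsUnit M.det)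
    (u w : ι → R) :
    (M + Matrix.vecMulVec u w).det = M.det * (1 + w ⬝ᵥ M⁻¹ *ᵥ u) := by
  rw [Matrix.vecMulVec_eq Unit, Matrix.det_add_replicateCol_mul_replicateRow hM,
    Matrix.mul_assoc, ← Matrix.replicateCol_mulVec]
  simp

lemma inv_add_vecMulVec {K : Type*} [Field K] {M : Matrix ι ι K} (hM : IsUnit M.det)
    {u w : ι → K} (h : 1 + w ⬝ᵥ M⁻¹ *ᵥ u ≠ 0) :
    (M + Matrix.vecMulVec u w)⁻¹ =
      M⁻¹ - (1 + w ⬝ᵥ M⁻¹ *ᵥ u)⁻¹ • Matrix.vecMulVec (M⁻¹ *ᵥ u) (w ᵥ* M⁻¹) := by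
  refine Matrix.inv_eq_right_inv ?_
  have hMu : M *ᵥ M⁻¹ *ᵥ u = u := by
    rw [Matrix.mulVec_mulVec, Matrix.mul_nonsing_inv _ hM, Matrix.one_mulVec]
  set P := Matrix.vecMulVec u (w ᵥ* M⁻¹) with hP
  have hcancel : P - (1 + w ⬝ᵥ M⁻¹ *ᵥ u)⁻¹ • (P + (w ⬝ᵥ M⁻¹ *ᵥ u) • P) = 0 := by
    rw [show P + (w ⬝ᵥ M⁻¹ *ᵥ u) • P = (1 + w ⬝ᵥ M⁻¹ *ᵥ u) • P by
      rw [add_smul, one_smul], smul_smul, inv_mul_cancel₀ h, one_smul, sub_self]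
  rw [mul_sub, add_mul, mul_smul_comm, add_mul, Matrix.mul_nonsing_inv _ hM,
    Matrix.vecMulVec_mul, Matrix.mul_vecMulVec, hMu, Matrix.vecMulVec_mul_vecMulVec,
    Matrix.vecMulVec_smul, ← hP, add_sub_assoc, hcancel, add_zero]

lemma quadratic_inv_nonneg {M : Matrix ι ι ℝ} (hM : M.PosDef) (u : ι → ℝ) :
    0 ≤ u ⬝ᵥ M⁻¹ *ᵥ u := by
  simpa using hM.inv.posSemidef.dotProduct_mulVec_nonneg u

/-- Up to an additive constant, the logarithm of the density at `u` of the centred Gaussian vector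
with covariance matrix `M`. -/
noncomputable def logKernel (M : Matrix ι ι ℝ) (u : ι → ℝ) : ℝ :=
  -(Real.log M.det + u ⬝ᵥ M⁻¹ *ᵥ u) / 2

@[fun_prop]
lemma continuous_logKernel (M : Matrix ι ι ℝ) : Continuous (logKernel M) := by
  unfold logKernel
  fun_prop

lemma dotProduct_inv_mulVec_comm {M : Matrix ι ι ℝ} (hM : M.IsHermitian) (u w : ι → ℝ) :
    u ⬝ᵥ M⁻¹ *ᵥ w = w ⬝ᵥ M⁻¹ *ᵥ u := by
  have hsymm : (M⁻¹)ᵀ = M⁻¹ := by simpa using hM.inv.eq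
  rw [Matrix.dotProduct_mulVec, ← Matrix.mulVec_transpose, hsymm, dotProduct_comm]

lemma logKernel_sub_smul {M : Matrix ι ι ℝ} (hM : M.IsHermitian) (u w : ι → ℝ) (x : ℝ) :
    logKernel M (u - x • w) =
      logKernel M u + (w ⬝ᵥ M⁻¹ *ᵥ u * x - w ⬝ᵥ M⁻¹ *ᵥ w * x ^ 2 / 2) := by
  simp only [logKernel, Matrix.mulVec_sub, Matrix.mulVec_smul, sub_dotProduct, dotProduct_sub,
    dotProduct_smul, smul_dotProduct, smul_eq_mul, dotProduct_inv_mulVec_comm hM u w]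
  ring

lemma logKernel_add_smul_vecMulVec {M : Matrix ι ι ℝ} (hM : M.PosDef) (v : ℝ≥0) (u w : ι → ℝ) :
    logKernel (M + (v : ℝ) • Matrix.vecMulVec w w) u =
      logKernel M u + (v * (w ⬝ᵥ M⁻¹ *ᵥ u) ^ 2 / (2 * (1 + v * (w ⬝ᵥ M⁻¹ *ᵥ w))) -
        Real.log (1 + v * (w ⬝ᵥ M⁻¹ *ᵥ w)) / 2) := by
  have hdet : IsUnit M.det := hM.det_pos.ne'.isUnit
  have hc := quadratic_inv_nonneg hM w
  have ht : 1 + v * (w ⬝ᵥ M⁻¹ *ᵥ w) ≠ 0 := by positivity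
  have ht' : 1 + w ⬝ᵥ M⁻¹ *ᵥ (v : ℝ) • w ≠ 0 := by
    rwa [Matrix.mulVec_smul, dotProduct_smul, smul_eq_mul]
  rw [logKernel, ← Matrix.smul_vecMulVec, det_add_vecMulVec hdet, inv_add_vecMulVec hdet ht',
    Matrix.mulVec_smul, dotProduct_smul, smul_eq_mul, Real.log_mul hdet.ne_zero ht,
    Matrix.sub_mulVec, Matrix.smul_mulVec, Matrix.vecMulVec_mulVec, dotProduct_sub,
    dotProduct_smul, ← Matrix.dotProduct_mulVec]
  simp only [op_smul_eq_smul, dotProduct_smul, smul_eq_mul,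
    dotProduct_inv_mulVec_comm hM.isHermitian u w, logKernel]
  field_simp
  ring

/-- Adding an independent Gaussian multiple of `w` updates the covariance by `w wᵀ`. -/
lemma lintegral_exp_logKernel_sub_smul {M : Matrix ι ι ℝ} (hM : M.PosDef) (v : ℝ≥0)
    (u w : ι → ℝ) :
    ∫⁻ x, ENNReal.ofReal (Real.exp (logKernel M (u - x • w))) ∂gaussianReal 0 v =
      ENNReal.ofReal (Real.exp (logKernel (M + (v : ℝ) • Matrix.vecMulVec w w) u)) := by
  simp_rw [logKernel_sub_smul hM.isHermitian, logKernel_add_smul_vecMulVec hM, Real.exp_add,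
    ENNReal.ofReal_mul (Real.exp_pos _).le]
  rw [lintegral_const_mul _ (by fun_prop),
    lintegral_exp_quadratic_gaussianReal v _ (quadratic_inv_nonneg hM w)]

lemma lmarginal_exp_logKernel_sub_sum [DecidableEq σ] {M : Matrix ι ι ℝ} (hM : M.PosDef) (v : ℝ≥0)
    (w : κ → ι → ℝ) (f : κ ↪ σ) (T : Finset κ) {u : (σ → ℝ) → ι → ℝ} (hu : Measurable u)
    (huT : DependsOn u (T.map f : Set σ)ᶜ) (x : σ → ℝ) :
    (∫⋯∫⁻_T.map f, (fun x => ENNReal.ofReal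
        (Real.exp (logKernel M (u x - ∑ j ∈ T, x (f j) • w j)))) ∂fun _ => gaussianReal 0 v) x =
      ENNReal.ofReal (Real.exp
        (logKernel (M + (v : ℝ) • ∑ j ∈ T, Matrix.vecMulVec (w j) (w j)) (u x))) := by
  classical
  induction T using Finset.induction_on generalizing u x with
  | empty => simp
  | insert i T hi ih =>
    have hmeas : Measurable fun x : σ → ℝ => ENNReal.ofReal
        (Real.exp (logKernel M (u x - ∑ j ∈ insert i T, x (f j) • w j))) := by
      have := (continuous_logKernel M).measurable
      fun_prop
    have hfi : f i ∉ T.map f := by simpa using hi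
    have hu_update (y : ℝ) : u (Function.update x (f i) y) = u x := huT fun s hs =>
      Function.update_of_ne (by rintro rfl; simp at hs) _ _
    have huT' : DependsOn (fun x => u x - x (f i) • w i) (T.map f : Set σ)ᶜ := fun x y hxy => by
      have hu_eq : u x = u y := huT.mono (by simp [Finset.map_insert]) hxy
      simp only [hu_eq, hxy (f i) (by simpa using hi)]
    rw [Finset.map_insert, lmarginal_insert _ hmeas hfi]
    simp_rw [Finset.sum_insert hi, ← sub_sub]
    simp_rw [ih (by fun_prop) huT', hu_update, Function.update_self]
    rw [lintegral_exp_logKernel_sub_smul (posDef_add_smul_sum_vecMulVec hM v w T),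
      smul_add, add_assoc, add_comm ((v : ℝ) • ∑ j ∈ T, _)]

end RankOneUpdates

/-! ### Sums of independent identically distributed variables -/

section Tails

variable {E I : Type*} [MeasurableSpace E] {μ : Measure E} [IsProbabilityMeasure μ] [Fintype I]

lemma lintegral_exp_sum_pi_le_one {f : E → ℝ} (hf : Measurable f)
    (h : ∫⁻ x, ENNReal.ofReal (Real.exp (f x)) ∂μ ≤ 1) :
    ∫⁻ x, ENNReal.ofReal (Real.exp (∑ i, f (x i))) ∂(Measure.pi fun _ : I => μ) ≤ 1 := by
  have hF : Measurable fun x => ENNReal.ofReal (Real.exp (f x)) := by fun_prop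
  have hind : iIndepFun (fun (i : I) (x : I → E) => ENNReal.ofReal (Real.exp (f (x i))))
      (Measure.pi fun _ : I => μ) :=
    iIndepFun_pi (X := fun _ x => ENNReal.ofReal (Real.exp (f x))) fun _ => hF.aemeasurable
  simp_rw [Real.exp_sum, ENNReal.ofReal_prod_of_nonneg fun _ _ => (Real.exp_pos _).le]
  rw [lintegral_prod_eq_prod_lintegral_of_indepFun _ _ hind
    fun i => hF.comp (measurable_pi_apply i)]
  refine Finset.prod_le_one' fun i _ => ?_
  rwa [(measurePreserving_eval (fun _ : I => μ) i).lintegral_comp hF]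

lemma measure_pi_le_sum_le_exp_neg {f : E → ℝ} (hf : Measurable f)
    (h : ∫⁻ x, ENNReal.ofReal (Real.exp (f x)) ∂μ ≤ 1) (τ : ℝ) :
    (Measure.pi fun _ : I => μ) {x | τ ≤ ∑ i, f (x i)} ≤ ENNReal.ofReal (Real.exp (-τ)) := by
  have hmeas : Measurable fun x : I → E => ENNReal.ofReal (Real.exp (∑ i, f (x i))) := by fun_prop
  calc (Measure.pi fun _ : I => μ) {x | τ ≤ ∑ i, f (x i)}
      ≤ (Measure.pi fun _ : I => μ) {x | ENNReal.ofReal (Real.exp τ) ≤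
          ENNReal.ofReal (Real.exp (∑ i, f (x i)))} :=
        measure_mono fun x hx => ENNReal.ofReal_le_ofReal (Real.exp_le_exp.2 hx)
    _ ≤ (∫⁻ x, ENNReal.ofReal (Real.exp (∑ i, f (x i))) ∂(Measure.pi fun _ : I => μ)) /
          ENNReal.ofReal (Real.exp τ) :=
        meas_ge_le_lintegral_div hmeas.aemeasurable (by simp [Real.exp_pos]) ENNReal.ofReal_ne_top
    _ ≤ 1 / ENNReal.ofReal (Real.exp τ) :=
        ENNReal.div_le_div_right (lintegral_exp_sum_pi_le_one hf h) _
    _ = ENNReal.ofReal (Real.exp (-τ)) := by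
        rw [one_div, Real.exp_neg, ENNReal.ofReal_inv_of_pos (Real.exp_pos _)]

lemma integral_sum_pi {f : E → ℝ} (hf : Integrable f μ) :
    ∫ x, ∑ i, f (x i) ∂(Measure.pi fun _ : I => μ) = Fintype.card I * μ[f] := by
  rw [integral_finsetSum _ fun i _ => integrable_comp_eval hf]
  simp [integral_comp_eval (μ := fun _ : I => μ) hf.aestronglyMeasurable]

lemma measure_pi_sum_lt_le_variance [Nonempty I] {f : E → ℝ} (hf : MemLp f 2 μ) {δ : ℝ}
    (hδ : 0 < δ) :
    (Measure.pi fun _ : I => μ) {x | ∑ i, f (x i) < Fintype.card I * (μ[f] - δ)} ≤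
      ENNReal.ofReal (Var[f; μ] / (Fintype.card I * δ ^ 2)) := by
  have hcard : (0 : ℝ) < Fintype.card I := Nat.cast_pos.2 Fintype.card_pos
  have hsum : MemLp (fun x : I → E => ∑ i, f (x i)) 2 (Measure.pi fun _ : I => μ) :=
    memLp_finsetSum _ fun i _ =>
      hf.comp_measurePreserving (measurePreserving_eval (fun _ : I => μ) i)
  have hvar : Var[fun x : I → E => ∑ i, f (x i); Measure.pi fun _ : I => μ] =
      Fintype.card I * Var[f; μ] := by
    have h := variance_sum_pi (μ := fun _ : I => μ) (X := fun _ => f) fun _ => hf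
    simpa [Finset.sum_fn] using h
  refine (measure_mono fun x hx => ?_).trans
    ((meas_ge_le_variance_div_sq hsum (mul_pos hcard hδ)).trans_eq ?_)
  · rw [Set.mem_ofPred_eq] at hx ⊢
    rw [integral_sum_pi (hf.integrable one_le_two), le_abs, neg_sub]
    right
    linarith
  · rw [hvar]
    congr 1
    field_simp

lemma measurePreserving_comp_embedding {J : Type*} [Fintype J] (μ : Measure E)
    [IsProbabilityMeasure μ] (f : I ↪ J) :
    MeasurePreserving (fun a : J → E => a ∘ f) (Measure.pi fun _ => μ) (Measure.pi fun _ => μ) := by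
  have hm (i : I) : Measurable fun a : J → E => a (f i) := measurable_pi_apply _
  have hind : iIndepFun (fun (j : J) (a : J → E) => a j) (Measure.pi fun _ => μ) :=
    iIndepFun_pi (X := fun _ x => x) fun _ => aemeasurable_id
  refine ⟨measurable_pi_lambda _ hm, ?_⟩
  calc (Measure.pi fun _ => μ).map (fun a : J → E => a ∘ f)
      = Measure.pi fun i => (Measure.pi fun _ => μ).map fun a : J → E => a (f i) :=
        (iIndepFun_iff_map_fun_eq_pi_map fun i => (hm i).aemeasurable).1 (hind.precomp f.injective)
    _ = Measure.pi fun _ => μ := by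
        congr with i : 1
        exact (measurePreserving_eval (fun _ : J => μ) (f i)).map_eq

end Tails

/-! ### Information densities -/

section InfoDensity

/-- The law of one row of the model: the coefficients in the row of the measurement matrix have
variance `v` and the entries in the row of the noise have variance `s`. -/
noncomputable def rowLaw (σ ι : Type*) [Fintype σ] [Fintype ι] (v s : ℝ≥0) :
    Measure ((σ → ℝ) × (ι → ℝ)) :=
  (Measure.pi fun _ => gaussianReal 0 v).prod (Measure.pi fun _ => gaussianReal 0 s)

instance {σ ι : Type*} [Fintype σ] [Fintype ι] {v s : ℝ≥0} :
    IsProbabilityMeasure (rowLaw σ ι v s) := by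
  unfold rowLaw
  infer_instance

variable {ι κ κ' σ : Type*}

/-- A row of the measurement, for the signal with rows `W`, the coefficients `a` of these rows and
the noise `z`. -/
def rowMeasurement [Fintype κ] (W : κ → ι → ℝ) (a : κ → ℝ) (z : ι → ℝ) : ι → ℝ :=
  ∑ j, a j • W j + z

lemma rowMeasurement_sub_sum_compl [Fintype κ] [DecidableEq κ] (W w : κ → ι → ℝ) (T : Finset κ)
    (a : κ → ℝ) (z : ι → ℝ) :
    rowMeasurement W a z - ∑ j ∈ Tᶜ, a j • w j =
      rowMeasurement (T.piecewise W (W - w)) a z := by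
  have hrow (j) : a j • T.piecewise W (W - w) j = a j • W j - if j ∈ Tᶜ then a j • w j else 0 := by
    by_cases hj : j ∈ T <;> simp [hj, smul_sub]
  simp only [rowMeasurement, hrow, Finset.sum_sub_distrib, Finset.sum_ite_mem, Finset.univ_inter]
  abel

/-- The covariance matrix `s I + v ∑_{j ∈ T} w_j w_jᵀ` of a row of the measurement given the
coefficients outside `T`, when the signal has rows `w`. -/
def rowCov [DecidableEq ι] (v s : ℝ≥0) (w : κ → ι → ℝ) (T : Finset κ) : Matrix ι ι ℝ :=
  (s : ℝ) • 1 + (v : ℝ) • ∑ j ∈ T, Matrix.vecMulVec (w j) (w j)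

lemma posDef_rowCov [Finite ι] [DecidableEq ι] (v : ℝ≥0) {s : ℝ≥0} (hs : s ≠ 0) (w : κ → ι → ℝ)
    (T : Finset κ) : (rowCov v s w T).PosDef :=
  posDef_add_smul_sum_vecMulVec (Matrix.PosDef.one.smul (by positivity)) v w T

lemma continuous_rowCov [DecidableEq ι] (v s : ℝ≥0) (T : Finset κ) :
    Continuous fun w : κ → ι → ℝ => rowCov v s w T := by
  unfold rowCov
  fun_prop

lemma dependsOn_sub_sum_compl [Fintype κ] [DecidableEq κ] {f : κ ↪ σ} {T : Finset κ}
    {y : (σ → ℝ) → ι → ℝ}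
    (hy : DependsOn y (T.map f : Set σ)ᶜ) (w : κ → ι → ℝ) :
    DependsOn (fun a => y a - ∑ j ∈ Tᶜ, a (f j) • w j) (T.map f : Set σ)ᶜ := fun a b hab => by
  have hcoeff (j) (hj : j ∈ Tᶜ) : a (f j) • w j = b (f j) • w j := by
    rw [hab (f j) (by simpa using hj)]
  simp only [hy hab, Finset.sum_congr rfl hcoeff]

variable [Fintype ι] [Fintype κ] [Fintype κ'] [DecidableEq ι] [DecidableEq κ]

/-- Up to an additive constant, the logarithm of the conditional density of a row `y` of the
measurement given the coefficients `a j` with `j ∉ T`, when the signal has rows `w`. -/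
noncomputable def condLogDensity (v s : ℝ≥0) (w : κ → ι → ℝ) (T : Finset κ) (a : κ → ℝ)
    (y : ι → ℝ) : ℝ :=
  logKernel (rowCov v s w T) (y - ∑ j ∈ Tᶜ, a j • w j)

/-- The conditional information density between the coefficients in `T` and a row `y` of the
measurement given the other coefficients, when the signal has rows `w`. -/
noncomputable def infoDensity (v s : ℝ≥0) (w : κ → ι → ℝ) (T : Finset κ) (a : κ → ℝ)
    (y : ι → ℝ) : ℝ :=
  condLogDensity v s w ∅ a y - condLogDensity v s w T a y

lemma continuous_infoDensity (v s : ℝ≥0) (w : κ → ι → ℝ) (T : Finset κ) :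
    Continuous fun p : (κ → ℝ) × (ι → ℝ) => infoDensity v s w T p.1 p.2 := by
  unfold infoDensity condLogDensity
  fun_prop

lemma dependsOn_condLogDensity (v s : ℝ≥0) (w : κ → ι → ℝ) {f : κ ↪ σ} {T : Finset κ}
    {y : (σ → ℝ) → ι → ℝ} (hy : DependsOn y (T.map f : Set σ)ᶜ) :
    DependsOn (fun a => condLogDensity v s w T (a ∘ f) (y a)) (T.map f : Set σ)ᶜ :=
  fun _ _ hab => congrArg (logKernel (rowCov v s w T)) (dependsOn_sub_sum_compl hy w hab)

lemma lmarginal_exp_condLogDensity_empty [DecidableEq σ] (v : ℝ≥0) {s : ℝ≥0} (hs : s ≠ 0)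
    (w : κ → ι → ℝ) {f : κ ↪ σ} {T : Finset κ} {y : (σ → ℝ) → ι → ℝ} (hy : Measurable y)
    (hyT : DependsOn y (T.map f : Set σ)ᶜ) (a : σ → ℝ) :
    (∫⋯∫⁻_T.map f, (fun a => ENNReal.ofReal (Real.exp (condLogDensity v s w ∅ (a ∘ f) (y a))))
      ∂fun _ => gaussianReal 0 v) a =
      ENNReal.ofReal (Real.exp (condLogDensity v s w T (a ∘ f) (y a))) := by
  have hM : ((s : ℝ) • (1 : Matrix ι ι ℝ)).PosDef := Matrix.PosDef.one.smul (by positivity)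
  convert lmarginal_exp_logKernel_sub_sum hM v w f T (by fun_prop)
    (dependsOn_sub_sum_compl hyT w) a using 6 with a
  · simp only [condLogDensity, rowCov, Finset.sum_empty, smul_zero, add_zero, Finset.compl_empty,
      Function.comp_apply, sub_sub, Finset.sum_compl_add_sum]
  · rfl

lemma measurable_infoDensity_rowMeasurement [Countable σ] (v s : ℝ≥0) (w : κ → ι → ℝ)
    (W : κ' → ι → ℝ) (T : Finset κ) (S' : κ → σ) (S : κ' → σ) :
    Measurable fun p : (σ → ℝ) × (ι → ℝ) =>
      infoDensity v s w T (p.1 ∘ S') (rowMeasurement W (p.1 ∘ S) p.2) := by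
  refine ((continuous_infoDensity v s w T).comp (.prodMk ?_ ?_)).measurable
  · fun_prop
  · change Continuous fun p : (σ → ℝ) × (ι → ℝ) => ∑ j, p.1 (S j) • W j + p.2
    fun_prop

variable [Fintype σ]

lemma lintegral_pi_exp_infoDensity_le_one (v : ℝ≥0) {s : ℝ≥0} (hs : s ≠ 0) (w : κ → ι → ℝ)
    {f : κ ↪ σ} {T : Finset κ} {y : (σ → ℝ) → ι → ℝ} (hy : Measurable y)
    (hyT : DependsOn y (T.map f : Set σ)ᶜ) :
    ∫⁻ a, ENNReal.ofReal (Real.exp (infoDensity v s w T (a ∘ f) (y a)))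
      ∂(Measure.pi fun _ : σ => gaussianReal 0 v) ≤ 1 := by
  classical
  have hmarg (a : σ → ℝ) : (∫⋯∫⁻_T.map f, (fun a => ENNReal.ofReal (Real.exp
      (infoDensity v s w T (a ∘ f) (y a)))) ∂fun _ => gaussianReal 0 v) a = 1 := by
    have hconst (b : T.map f → ℝ) := dependsOn_condLogDensity v s w hyT
      (show ∀ i ∈ ((T.map f : Finset σ) : Set σ)ᶜ, Function.updateFinset a (T.map f) b i = a i from
        fun i hi => by simp_all [Function.updateFinset])
    have hker := lmarginal_exp_condLogDensity_empty v hs w hy hyT a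
    simp only [lmarginal, infoDensity, sub_eq_add_neg, Real.exp_add,
      ENNReal.ofReal_mul (Real.exp_pos _).le, hconst] at hker ⊢
    rw [lintegral_mul_const' _ _ ENNReal.ofReal_ne_top, hker,
      ← ENNReal.ofReal_mul (Real.exp_pos _).le, ← Real.exp_add, add_neg_cancel, Real.exp_zero,
      ENNReal.ofReal_one]
  calc _ ≤ ∫⁻ _, 1 ∂(Measure.pi fun _ : σ => gaussianReal 0 v) := by
        refine lintegral_le_of_lmarginal_le (T.map f) ?_ measurable_const fun a => ?_
        · have := (continuous_infoDensity v s w T).measurable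
          fun_prop
        · rw [hmarg a]
          simp [lmarginal]
    _ = 1 := by simp

lemma lintegral_exp_infoDensity_le_one (v : ℝ≥0) {s : ℝ≥0} (hs : s ≠ 0)
    (w : κ → ι → ℝ) (W : κ' → ι → ℝ) {T : Finset κ} {S' : κ ↪ σ} {S : κ' → σ}
    (hT : ∀ j ∈ T, S' j ∉ Set.range S) :
    ∫⁻ p, ENNReal.ofReal (Real.exp
      (infoDensity v s w T (p.1 ∘ S') (rowMeasurement W (p.1 ∘ S) p.2))) ∂rowLaw σ ι v s ≤ 1 := by
  have hmeas := (measurable_infoDensity_rowMeasurement v s w W T S' S).exp.ennreal_ofReal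
  rw [rowLaw, lintegral_prod_symm _ hmeas.aemeasurable]
  have hz (z : ι → ℝ) : ∫⁻ a, ENNReal.ofReal (Real.exp
      (infoDensity v s w T (a ∘ S') (rowMeasurement W (a ∘ S) z)))
      ∂(Measure.pi fun _ : σ => gaussianReal 0 v) ≤ 1 := by
    refine lintegral_pi_exp_infoDensity_le_one v hs w
      (y := fun a => rowMeasurement W (a ∘ S) z) ?_ fun a b hab => ?_
    · unfold rowMeasurement
      fun_prop
    · have hS : a ∘ S = b ∘ S := funext fun j => hab _ fun hj => by
        obtain ⟨j', hj', hjj'⟩ := Finset.mem_map.1 hj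
        exact hT j' hj' ⟨j, hjj'.symm⟩
      simp only [hS]
  exact (lintegral_mono hz).trans (by simp)

end InfoDensity

/-! ### Moments of the information densities -/

section Moments

variable {ι κ Ω : Type*} [Fintype κ] [MeasurableSpace Ω] {P : Measure Ω} {v s : ℝ≥0}

lemma covariance_comp_measurePreserving {Ω' : Type*} [MeasurableSpace Ω'] {Q : Measure Ω'}
    {g : Ω → Ω'} (hg : MeasurePreserving g P Q) {X Y : Ω' → ℝ} (hX : AEStronglyMeasurable X Q)
    (hY : AEStronglyMeasurable Y Q) : cov[X ∘ g, Y ∘ g; P] = cov[X, Y; Q] := by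
  rw [← hg.map_eq] at hX hY ⊢
  exact (covariance_map hX hY hg.aemeasurable).symm

lemma memLp_eval_pi_gaussianReal (i : κ) {p : ℝ≥0∞} (hp : p ≠ ∞) :
    MemLp (fun a : κ → ℝ => a i) p (Measure.pi fun _ => gaussianReal 0 v) :=
  (memLp_id_gaussianReal' p hp).comp_measurePreserving (measurePreserving_eval _ i)

lemma integral_eval_pi_gaussianReal (i : κ) :
    ∫ a : κ → ℝ, a i ∂(Measure.pi fun _ => gaussianReal 0 v) = 0 := by
  rw [integral_comp_eval (μ := fun _ : κ => gaussianReal 0 v) (f := fun x : ℝ => x)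
    aestronglyMeasurable_id, integral_id_gaussianReal]

lemma covariance_eval_pi_gaussianReal [DecidableEq κ] (i j : κ) :
    cov[fun a : κ → ℝ => a i, fun a => a j; Measure.pi fun _ => gaussianReal 0 v] =
      if i = j then (v : ℝ) else 0 := by
  split_ifs with h
  · subst h
    have hid : AEStronglyMeasurable (fun x : ℝ => x) (gaussianReal 0 v) := aestronglyMeasurable_id
    rw [← variance_fun_id_gaussianReal (μ := 0), ← covariance_self hid.aemeasurable]
    exact covariance_comp_measurePreserving
      (measurePreserving_eval (fun _ : κ => gaussianReal 0 v) i) hid hid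
  · exact ((iIndepFun_pi (X := fun (_ : κ) (x : ℝ) => x) fun _ => aemeasurable_id).indepFun
      h).covariance_eq_zero (memLp_eval_pi_gaussianReal i (by simp))
      (memLp_eval_pi_gaussianReal j (by simp))

lemma covariance_sum_smul_pi_gaussianReal (V : κ → ι → ℝ) (q r : ι) :
    cov[fun a : κ → ℝ => (∑ j, a j • V j) q, fun a => (∑ j, a j • V j) r;
      Measure.pi fun _ => gaussianReal 0 v] = v * ∑ j, V j q * V j r := by
  classical
  have hL (q : ι) (j : κ) : MemLp (fun a : κ → ℝ => a j * V j q) 2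
      (Measure.pi fun _ => gaussianReal 0 v) :=
    (memLp_eval_pi_gaussianReal j (by simp)).mul_const _
  simp only [Finset.sum_apply, Pi.smul_apply, smul_eq_mul]
  rw [covariance_fun_sum_fun_sum (hL q) (hL r), Finset.mul_sum]
  simp only [covariance_mul_const_left, covariance_mul_const_right,
    covariance_eval_pi_gaussianReal, ite_mul, zero_mul, Finset.sum_ite_eq, Finset.mem_univ, if_true]
  exact Finset.sum_congr rfl fun j _ => by ring

lemma memLp_sum_smul_pi_gaussianReal (V : κ → ι → ℝ) (q : ι) {p : ℝ≥0∞} (hp : p ≠ ∞) :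
    MemLp (fun a : κ → ℝ => (∑ j, a j • V j) q) p (Measure.pi fun _ => gaussianReal 0 v) := by
  simp only [Finset.sum_apply, Pi.smul_apply, smul_eq_mul]
  exact memLp_finsetSum _ fun j _ => (memLp_eval_pi_gaussianReal j hp).mul_const _

variable [Fintype ι]

lemma memLp_rowMeasurement (V : κ → ι → ℝ) (q : ι) {p : ℝ≥0∞} (hp : p ≠ ∞) :
    MemLp (fun x => rowMeasurement V x.1 x.2 q) p (rowLaw κ ι v s) :=
  ((memLp_sum_smul_pi_gaussianReal V q hp).comp_fst _).add
    ((memLp_eval_pi_gaussianReal q hp).comp_snd _)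

lemma integral_rowMeasurement (V : κ → ι → ℝ) (q : ι) :
    ∫ x, rowMeasurement V x.1 x.2 q ∂rowLaw κ ι v s = 0 := by
  have hint (j : κ) := (memLp_eval_pi_gaussianReal (v := v) j ENNReal.one_ne_top).integrable le_rfl
  have hsum : ∫ a : κ → ℝ, (∑ j, a j • V j) q ∂(Measure.pi fun _ => gaussianReal 0 v) = 0 := by
    simp only [Finset.sum_apply, Pi.smul_apply, smul_eq_mul]
    rw [integral_finsetSum _ fun j _ => (hint j).mul_const _]
    simp [integral_mul_const, integral_eval_pi_gaussianReal]
  simp only [rowMeasurement, Pi.add_apply, rowLaw]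
  rw [integral_add
    (((memLp_sum_smul_pi_gaussianReal V q ENNReal.one_ne_top).comp_fst _).integrable le_rfl)
    (((memLp_eval_pi_gaussianReal q ENNReal.one_ne_top).comp_snd _).integrable le_rfl),
    integral_fun_fst (fun a : κ → ℝ => (∑ j, a j • V j) q),
    integral_fun_snd (fun z : ι → ℝ => z q), hsum, integral_eval_pi_gaussianReal]
  simp

lemma dotProduct_mulVec_eq_sum {R : Type*} [CommSemiring R] (N : Matrix ι ι R) (u : ι → R) :
    u ⬝ᵥ N *ᵥ u = ∑ q, ∑ r, N q r * (u q * u r) := by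
  simp only [dotProduct, Matrix.mulVec, Finset.mul_sum]
  exact Finset.sum_congr rfl fun q _ => Finset.sum_congr rfl fun r _ => by ring

lemma integral_dotProduct_mulVec [IsProbabilityMeasure P] {X : Ω → ι → ℝ}
    (hX : ∀ q, MemLp (fun ω => X ω q) 2 P) (hmean : ∀ q, ∫ ω, X ω q ∂P = 0) {C : Matrix ι ι ℝ}
    (hC : ∀ q r, cov[fun ω => X ω q, fun ω => X ω r; P] = C q r) (N : Matrix ι ι ℝ) :
    ∫ ω, X ω ⬝ᵥ N *ᵥ X ω ∂P = (N * C).trace := by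
  have hint (q r) : Integrable (fun ω => N q r * (X ω q * X ω r)) P :=
    ((hX q).integrable_mul (hX r)).const_mul _
  have hprod (q r) : ∫ ω, X ω r * X ω q ∂P = C r q := by
    rw [← hC, covariance_eq_sub (hX r) (hX q), hmean, zero_mul, sub_zero]
    rfl
  simp_rw [dotProduct_mulVec_eq_sum]
  rw [integral_finsetSum _ fun q _ => integrable_finsetSum _ fun r _ => hint q r]
  refine Finset.sum_congr rfl fun q _ => ?_
  rw [integral_finsetSum _ fun r _ => hint q r]
  simp only [Matrix.diag_apply, Matrix.mul_apply]
  refine Finset.sum_congr rfl fun r _ => ?_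
  rw [integral_const_mul, ← hprod]
  simp_rw [mul_comm (X _ r)]

lemma memLp_dotProduct_mulVec {X : Ω → ι → ℝ} (hX : ∀ q, MemLp (fun ω => X ω q) 4 P)
    (N : Matrix ι ι ℝ) : MemLp (fun ω => X ω ⬝ᵥ N *ᵥ X ω) 2 P := by
  have : ENNReal.HolderTriple 4 4 2 := ⟨by
    rw [show (4 : ℝ≥0∞) = 2 * 2 by norm_num, ENNReal.mul_inv (by simp) (by simp), ← mul_add,
      ENNReal.inv_two_add_inv_two, mul_one]⟩
  simp_rw [dotProduct_mulVec_eq_sum]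
  exact memLp_finsetSum _ fun q _ => memLp_finsetSum _ fun r _ =>
    ((hX r).mul (hX q)).const_mul (N q r)

variable [DecidableEq ι]

lemma memLp_logKernel [IsFiniteMeasure P] {X : Ω → ι → ℝ} (hX : ∀ q, MemLp (fun ω => X ω q) 4 P)
    (M : Matrix ι ι ℝ) : MemLp (fun ω => logKernel M (X ω)) 2 P := by
  have h := ((memLp_const (Real.log M.det)).add (memLp_dotProduct_mulVec hX M⁻¹)).const_mul
    (-(1 / 2))
  refine h.ae_eq (.of_forall fun ω => ?_)
  simp only [logKernel, Pi.add_apply]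
  ring

lemma integral_logKernel [IsProbabilityMeasure P] {X : Ω → ι → ℝ}
    (hX : ∀ q, MemLp (fun ω => X ω q) 4 P) (hmean : ∀ q, ∫ ω, X ω q ∂P = 0) {C : Matrix ι ι ℝ}
    (hC : ∀ q r, cov[fun ω => X ω q, fun ω => X ω r; P] = C q r) (M : Matrix ι ι ℝ) :
    ∫ ω, logKernel M (X ω) ∂P = -(Real.log M.det + (M⁻¹ * C).trace) / 2 := by
  have hX2 (q) : MemLp (fun ω => X ω q) 2 P := (hX q).mono_exponent (by norm_num)
  unfold logKernel
  rw [integral_div, integral_neg, integral_add (integrable_const _)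
    ((memLp_dotProduct_mulVec hX _).integrable one_le_two), integral_dotProduct_mulVec hX2 hmean hC]
  simp

lemma covariance_rowMeasurement (V : κ → ι → ℝ) (q r : ι) :
    cov[fun x => rowMeasurement V x.1 x.2 q, fun x => rowMeasurement V x.1 x.2 r;
      rowLaw κ ι v s] = rowCov v s V Finset.univ q r := by
  set μ : Measure (κ → ℝ) := Measure.pi fun _ => gaussianReal 0 v
  set ν : Measure (ι → ℝ) := Measure.pi fun _ => gaussianReal 0 s
  have hL (q : ι) : MemLp (fun a : κ → ℝ => (∑ j, a j • V j) q) 2 μ :=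
    memLp_sum_smul_pi_gaussianReal V q (by simp)
  have hZ (q : ι) : MemLp (fun z : ι → ℝ => z q) 2 ν := memLp_eval_pi_gaussianReal q (by simp)
  have hLL : cov[fun x => (∑ j, x.1 j • V j) q, fun x => (∑ j, x.1 j • V j) r; μ.prod ν] =
      v * ∑ j, V j q * V j r := by
    rw [← covariance_sum_smul_pi_gaussianReal]
    exact covariance_comp_measurePreserving measurePreserving_fst (hL q).1 (hL r).1
  have hZZ : cov[fun x => x.2 q, fun x => x.2 r; μ.prod ν] = if q = r then (s : ℝ) else 0 := by
    rw [← covariance_eval_pi_gaussianReal]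
    exact covariance_comp_measurePreserving measurePreserving_snd (hZ q).1 (hZ r).1
  have hLZ (q r : ι) : cov[fun x => (∑ j, x.1 j • V j) q, fun x => x.2 r; μ.prod ν] = 0 :=
    covariance_fst_snd_prod (hL q) (hZ r)
  have hL' (q) := (hL q).comp_fst ν
  have hZ' (q) := (hZ q).comp_snd μ
  have hadd (q : ι) : (fun x : (κ → ℝ) × (ι → ℝ) => rowMeasurement V x.1 x.2 q) =
    (fun x => (∑ j, x.1 j • V j) q) + fun x => x.2 q := rfl
  rw [rowLaw, hadd, hadd, covariance_add_left (hL' q) (hZ' q) ((hL' r).add (hZ' r)),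
    covariance_add_right (hL' q) (hL' r) (hZ' r), covariance_add_right (hZ' q) (hL' r) (hZ' r),
    hLL, hLZ, covariance_comm, hLZ, hZZ]
  simp [rowCov, Matrix.one_apply, Matrix.sum_apply, Matrix.vecMulVec_apply, add_comm]

variable [DecidableEq κ]

lemma memLp_condLogDensity (W w : κ → ι → ℝ) (T : Finset κ) :
    MemLp (fun x => condLogDensity v s w T x.1 (rowMeasurement W x.1 x.2)) 2 (rowLaw κ ι v s) := by
  simp only [condLogDensity, rowMeasurement_sub_sum_compl]
  exact memLp_logKernel (fun q => memLp_rowMeasurement _ q (by simp)) _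

lemma memLp_infoDensity (W w : κ → ι → ℝ) (T : Finset κ) :
    MemLp (fun x => infoDensity v s w T x.1 (rowMeasurement W x.1 x.2)) 2 (rowLaw κ ι v s) :=
  (memLp_condLogDensity W w ∅).sub (memLp_condLogDensity W w T)

/-- The mean of `condLogDensity v s w T` when the signal has rows `W` instead of `w`; here
`T.piecewise W (W - w)` holds the rows left after subtracting `w j` from row `j` for `j ∉ T`. -/
noncomputable def meanCondLogDensity (v s : ℝ≥0) (W w : κ → ι → ℝ) (T : Finset κ) : ℝ :=
  -(Real.log (rowCov v s w T).det +
    ((rowCov v s w T)⁻¹ * rowCov v s (T.piecewise W (W - w)) Finset.univ).trace) / 2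

/-- The mean of `infoDensity v s w T` when the signal has rows `W`: the mutual information that a
decoder assuming rows `w` extracts about the coefficients in `T`. -/
noncomputable def meanInfoDensity (v s : ℝ≥0) (W w : κ → ι → ℝ) (T : Finset κ) : ℝ :=
  meanCondLogDensity v s W w ∅ - meanCondLogDensity v s W w T

lemma integral_condLogDensity (W w : κ → ι → ℝ) (T : Finset κ) :
    ∫ x, condLogDensity v s w T x.1 (rowMeasurement W x.1 x.2) ∂rowLaw κ ι v s =
      meanCondLogDensity v s W w T := by
  simp only [condLogDensity, rowMeasurement_sub_sum_compl]
  exact integral_logKernel (fun q => memLp_rowMeasurement _ q (by simp))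
    (integral_rowMeasurement _) (covariance_rowMeasurement _) _

lemma integral_infoDensity (W w : κ → ι → ℝ) (T : Finset κ) :
    ∫ x, infoDensity v s w T x.1 (rowMeasurement W x.1 x.2) ∂rowLaw κ ι v s =
      meanInfoDensity v s W w T := by
  have hint (T : Finset κ) := (memLp_condLogDensity (v := v) (s := s) W w T).integrable one_le_two
  simp only [infoDensity, meanInfoDensity, ← integral_condLogDensity]
  exact integral_sub (hint ∅) (hint T)

lemma continuous_meanCondLogDensity (hs : s ≠ 0) (W : κ → ι → ℝ) (T : Finset κ) :
    Continuous fun w => meanCondLogDensity v s W w T := by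
  have hdet (w : κ → ι → ℝ) : (rowCov v s w T).det ≠ 0 := (posDef_rowCov v hs w T).det_pos.ne'
  have hcov : Continuous fun w : κ → ι → ℝ => rowCov v s w T := continuous_rowCov v s T
  have hinv : Continuous fun w : κ → ι → ℝ => (rowCov v s w T)⁻¹ := by
    simp only [Matrix.inv_def, Ring.inverse_eq_inv']
    exact (hcov.matrix_det.inv₀ hdet).smul hcov.matrix_adjugate
  have hres : Continuous fun w : κ → ι → ℝ => T.piecewise W (W - w) :=
    continuous_pi fun j => by
      by_cases hj : j ∈ T
      · simpa only [Finset.piecewise_eq_of_mem _ _ _ hj] using continuous_const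
      · simpa only [Finset.piecewise_eq_of_notMem _ _ _ hj, Pi.sub_apply] using
          (by fun_prop : Continuous fun w : κ → ι → ℝ => W j - w j)
  exact (((hcov.matrix_det.log hdet).add
    (hinv.matrix_mul ((continuous_rowCov v s _).comp hres)).matrix_trace).neg).div_const 2

lemma continuous_meanInfoDensity (hs : s ≠ 0) (W : κ → ι → ℝ) (T : Finset κ) :
    Continuous fun w => meanInfoDensity v s W w T :=
  (continuous_meanCondLogDensity hs W ∅).sub (continuous_meanCondLogDensity hs W T)

lemma meanCondLogDensity_self (hs : s ≠ 0) (W : κ → ι → ℝ) (T : Finset κ) :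
    meanCondLogDensity v s W W T = -(Real.log (rowCov v s W T).det + Fintype.card ι) / 2 := by
  have hres : rowCov v s (T.piecewise W (W - W)) Finset.univ = rowCov v s W T := by
    have hrow (j) : Matrix.vecMulVec ((T.piecewise W (W - W)) j) ((T.piecewise W (W - W)) j) =
        if j ∈ T then Matrix.vecMulVec (W j) (W j) else 0 := by
      by_cases hj : j ∈ T <;> simp [hj]
    simp only [rowCov, hrow, Finset.sum_ite_mem, Finset.univ_inter]
  rw [meanCondLogDensity, hres,
    Matrix.nonsing_inv_mul _ (posDef_rowCov v hs W T).det_pos.ne'.isUnit, Matrix.trace_one]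

lemma meanInfoDensity_self (hs : s ≠ 0) (W : κ → ι → ℝ) (T : Finset κ) :
    meanInfoDensity v s W W T = Real.log
      (1 + ((v / s : ℝ≥0) : ℝ) • ∑ j ∈ T, Matrix.vecMulVec (W j) (W j) : Matrix ι ι ℝ).det / 2 := by
  have hcov : rowCov v s W T =
      (s : ℝ) • (1 + ((v / s : ℝ≥0) : ℝ) • ∑ j ∈ T, Matrix.vecMulVec (W j) (W j)) := by
    rw [rowCov, smul_add, smul_smul, ← NNReal.coe_mul, mul_div_cancel₀ _ hs]
  have hdet := (posDef_add_smul_sum_vecMulVec Matrix.PosDef.one (v / s) W T).det_pos.ne'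
  have hs' : (s : ℝ) ^ Fintype.card ι ≠ 0 := by positivity
  rw [meanInfoDensity, meanCondLogDensity_self hs, meanCondLogDensity_self hs, hcov,
    Matrix.det_smul, Real.log_mul hs' hdet]
  simp [rowCov]
  ring

end Moments

/-! ### Acceptance of candidates -/

section Candidates

variable {ι κ κ' σ I : Type*} [Fintype κ]

lemma sum_inv_card_pow_card_notMem_le {α : Type*} [Fintype α] [DecidableEq α] [DecidableEq κ]
    (B : Finset α) :
    ∑ f : κ → α, (Fintype.card α : ℝ)⁻¹ ^ ({j | f j ∉ B} : Finset κ).card ≤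
      ((B.card : ℝ) + 1) ^ Fintype.card κ := by
  have hsum : ∑ x : α, (if x ∉ B then (Fintype.card α : ℝ)⁻¹ else 1) ≤ B.card + 1 := by
    rw [Finset.sum_ite, Finset.sum_const, Finset.sum_const, nsmul_eq_mul, nsmul_eq_mul, mul_one,
      add_comm]
    simp only [not_not, Finset.filter_univ_mem]
    gcongr
    exact mul_inv_le_one_of_le₀ (Nat.cast_le.2 (Finset.card_le_univ _)) (Nat.cast_nonneg _)
  calc ∑ f : κ → α, (Fintype.card α : ℝ)⁻¹ ^ ({j | f j ∉ B} : Finset κ).card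
      = ∑ f : κ → α, ∏ j, (if f j ∉ B then (Fintype.card α : ℝ)⁻¹ else 1) := by
        simp only [Finset.prod_ite, Finset.prod_const, one_pow, mul_one]
    _ = (∑ x : α, (if x ∉ B then (Fintype.card α : ℝ)⁻¹ else 1)) ^ Fintype.card κ := by
        rw [← Finset.card_univ (α := κ), ← Finset.prod_const, Finset.prod_univ_sum,
          Fintype.piFinset_univ]
    _ ≤ _ := by gcongr

variable [Fintype ι] [Fintype σ]

lemma measurePreserving_rowLaw (v s : ℝ≥0) (S : κ ↪ σ) :
    MeasurePreserving (fun p : (σ → ℝ) × (ι → ℝ) => (p.1 ∘ S, p.2)) (rowLaw σ ι v s)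
      (rowLaw κ ι v s) :=
  (measurePreserving_comp_embedding (gaussianReal 0 v) S).prod (.id _)

variable [Fintype κ'] [Fintype I] [DecidableEq ι] [DecidableEq κ] {v s : ℝ≥0}

/-- The decoder accepts the locations `S'` for the candidate rows `w` if, for every nonempty set
`T` of rows, the information density between the coefficients in `T` and the data exceeds by `τ`
the logarithm of the number of possible locations of these rows. -/
def Accepts (v s : ℝ≥0) (w : κ → ι → ℝ) (τ : ℝ) (S' : κ ↪ σ) (A : I → σ → ℝ)
    (Y : I → ι → ℝ) : Prop :=
  ∀ T : Finset κ, T.Nonempty →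
    T.card * Real.log (Fintype.card σ) + τ ≤ ∑ i, infoDensity v s w T (A i ∘ S') (Y i)

lemma measurableSet_setOf_accepts (v s : ℝ≥0) (w : κ → ι → ℝ) (τ : ℝ) (S' : κ ↪ σ) :
    MeasurableSet {p : (I → σ → ℝ) × (I → ι → ℝ) | Accepts v s w τ S' p.1 p.2} := by
  have hmeas (T : Finset κ) (i : I) : Measurable fun p : (I → σ → ℝ) × (I → ι → ℝ) =>
      infoDensity v s w T (p.1 i ∘ S') (p.2 i) :=
    ((continuous_infoDensity v s w T).comp (.prodMk (by fun_prop) (by fun_prop))).measurable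
  simp only [Accepts, Set.ofPred_forall]
  exact .iInter fun T => .iInter fun _ => measurableSet_le measurable_const
    (Finset.measurable_fun_sum _ fun i _ => hmeas T i)

lemma measure_pi_le_sum_infoDensity_le [Nonempty σ] (hs : s ≠ 0) (w : κ → ι → ℝ) (W : κ' → ι → ℝ)
    {T : Finset κ} {S' : κ ↪ σ} {S : κ' → σ} (hT : ∀ j ∈ T, S' j ∉ Set.range S) (τ : ℝ) :
    (Measure.pi fun _ : I => rowLaw σ ι v s) {x | T.card * Real.log (Fintype.card σ) + τ ≤
      ∑ i, infoDensity v s w T ((x i).1 ∘ S') (rowMeasurement W ((x i).1 ∘ S) (x i).2)} ≤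
      ENNReal.ofReal ((Fintype.card σ : ℝ)⁻¹ ^ T.card * Real.exp (-τ)) := by
  have hexp : Real.exp (-(T.card * Real.log (Fintype.card σ) + τ)) =
      (Fintype.card σ : ℝ)⁻¹ ^ T.card * Real.exp (-τ) := by
    rw [neg_add, Real.exp_add, Real.exp_neg, Real.exp_nat_mul,
      Real.exp_log (Nat.cast_pos.2 Fintype.card_pos), inv_pow]
  rw [← hexp]
  exact measure_pi_le_sum_le_exp_neg (measurable_infoDensity_rowMeasurement v s w W T S' S)
    (lintegral_exp_infoDensity_le_one v hs w W hT) _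

lemma measure_pi_exists_accepts_le [Nonempty σ] (hs : s ≠ 0) (w : κ → ι → ℝ) (W : κ' → ι → ℝ)
    (S : κ' → σ) (τ : ℝ) :
    (Measure.pi fun _ : I => rowLaw σ ι v s) {x | ∃ S' : κ ↪ σ, ¬ Set.range S' ⊆ Set.range S ∧
      Accepts v s w τ S' (fun i => (x i).1)
        fun i => rowMeasurement W ((x i).1 ∘ S) (x i).2} ≤
      ENNReal.ofReal ((Fintype.card κ' + 1) ^ Fintype.card κ * Real.exp (-τ)) := by
  classical
  set B : Finset σ := Finset.univ.image S
  have hB (x : σ) : x ∉ B ↔ x ∉ Set.range S := by simp [B]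
  set missed : (κ ↪ σ) → Finset κ := fun S' => {j | S' j ∉ B}
  have hmissed (S' : κ ↪ σ) : ∀ j ∈ missed S', S' j ∉ Set.range S := by simp [missed, hB]
  calc _ ≤ (Measure.pi fun _ : I => rowLaw σ ι v s) (⋃ S' ∈ (Finset.univ : Finset (κ ↪ σ)),
          {x | (missed S').card * Real.log (Fintype.card σ) + τ ≤ ∑ i, infoDensity v s w (missed S')
            ((x i).1 ∘ S') (rowMeasurement W ((x i).1 ∘ S) (x i).2)}) := by
        refine measure_mono fun x ⟨S', hS', hacc⟩ => Set.mem_biUnion (Finset.mem_univ S') ?_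
        obtain ⟨_, ⟨j, rfl⟩, hj⟩ := Set.not_subset.1 hS'
        exact hacc _ ⟨j, by simpa [missed, hB] using hj⟩
    _ ≤ ∑ S' : κ ↪ σ, ENNReal.ofReal
          ((Fintype.card σ : ℝ)⁻¹ ^ (missed S').card * Real.exp (-τ)) :=
        (measure_biUnion_finset_le _ _).trans <| Finset.sum_le_sum fun S' _ =>
          measure_pi_le_sum_infoDensity_le hs w W (hmissed S') τ
    _ = ENNReal.ofReal
          ((∑ S' : κ ↪ σ, (Fintype.card σ : ℝ)⁻¹ ^ (missed S').card) * Real.exp (-τ)) := by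
        rw [Finset.sum_mul, ENNReal.ofReal_sum_of_nonneg fun _ _ => by positivity]
    _ ≤ _ := by
        gcongr
        calc ∑ S' : κ ↪ σ, (Fintype.card σ : ℝ)⁻¹ ^ (missed S').card
            ≤ ∑ f : κ → σ, (Fintype.card σ : ℝ)⁻¹ ^ ({j | f j ∉ B} : Finset κ).card := by
              refine (Finset.sum_map Finset.univ ⟨_, DFunLike.coe_injective⟩
                fun f : κ → σ =>
                  (Fintype.card σ : ℝ)⁻¹ ^ ({j | f j ∉ B} : Finset κ).card).symm.trans_le
                (Finset.sum_le_univ_sum_of_nonneg fun _ => by positivity)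
          _ ≤ ((B.card : ℝ) + 1) ^ Fintype.card κ := sum_inv_card_pow_card_notMem_le B
          _ ≤ _ := by gcongr; exact Finset.card_image_le

lemma measure_pi_sum_infoDensity_lt_le [Nonempty I] (w W : κ → ι → ℝ) (T : Finset κ) (S : κ ↪ σ)
    {δ : ℝ} (hδ : 0 < δ) :
    (Measure.pi fun _ : I => rowLaw σ ι v s) {x | ∑ i, infoDensity v s w T ((x i).1 ∘ S)
        (rowMeasurement W ((x i).1 ∘ S) (x i).2) <
          Fintype.card I * (meanInfoDensity v s W w T - δ)} ≤
      ENNReal.ofReal (Var[fun x => infoDensity v s w T x.1 (rowMeasurement W x.1 x.2);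
        rowLaw κ ι v s] / (Fintype.card I * δ ^ 2)) := by
  have hpi := measurePreserving_pi _ _ fun _ : I => measurePreserving_rowLaw (ι := ι) v s S
  have hmeas : Measurable fun x : (κ → ℝ) × (ι → ℝ) =>
      infoDensity v s w T x.1 (rowMeasurement W x.1 x.2) :=
    measurable_infoDensity_rowMeasurement v s w W T id id
  rw [← integral_infoDensity]
  refine le_trans (hpi.measure_preimage (s := {x : I → (κ → ℝ) × (ι → ℝ) | ∑ i,
    infoDensity v s w T (x i).1 (rowMeasurement W (x i).1 (x i).2) < _}) ?_).le
    (measure_pi_sum_lt_le_variance (memLp_infoDensity W w T) hδ)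
  exact (measurableSet_lt (Finset.measurable_fun_sum _ fun i _ =>
    hmeas.comp (measurable_pi_apply i)) measurable_const).nullMeasurableSet

lemma measure_pi_not_accepts_le [Nonempty I] (w W : κ → ι → ℝ) (S : κ ↪ σ) {τ : ℝ}
    {δ : Finset κ → ℝ} (hδ : ∀ T, T.Nonempty → 0 < δ T)
    (hτ : ∀ T : Finset κ, T.Nonempty → T.card * Real.log (Fintype.card σ) + τ ≤
      Fintype.card I * (meanInfoDensity v s W w T - δ T)) :
    (Measure.pi fun _ : I => rowLaw σ ι v s) {x | ¬ Accepts v s w τ S (fun i => (x i).1)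
        fun i => rowMeasurement W ((x i).1 ∘ S) (x i).2} ≤
      ENNReal.ofReal (∑ T : Finset κ with T.Nonempty,
        Var[fun x => infoDensity v s w T x.1 (rowMeasurement W x.1 x.2); rowLaw κ ι v s] /
          (Fintype.card I * δ T ^ 2)) := by
  calc _ ≤ (Measure.pi fun _ : I => rowLaw σ ι v s)
          (⋃ T ∈ ({T | T.Nonempty} : Finset (Finset κ)), {x | ∑ i, infoDensity v s w T
            ((x i).1 ∘ S) (rowMeasurement W ((x i).1 ∘ S) (x i).2) <
              Fintype.card I * (meanInfoDensity v s W w T - δ T)}) := by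
        refine measure_mono fun x hx => ?_
        simp only [Set.mem_ofPred_eq, Accepts, not_forall, not_le] at hx
        obtain ⟨T, hT, hlt⟩ := hx
        exact Set.mem_biUnion (by simpa using hT) (hlt.trans_le (hτ T hT))
    _ ≤ ∑ T : Finset κ with T.Nonempty, ENNReal.ofReal
          (Var[fun x => infoDensity v s w T x.1 (rowMeasurement W x.1 x.2); rowLaw κ ι v s] /
            (Fintype.card I * δ T ^ 2)) :=
        (measure_biUnion_finset_le _ _).trans <| Finset.sum_le_sum fun T hT =>
          measure_pi_sum_infoDensity_lt_le w W T S (hδ T (Finset.mem_filter.1 hT).2)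
    _ = _ := by
        rw [ENNReal.ofReal_sum_of_nonneg fun T _ =>
            div_nonneg (variance_nonneg _ _) (by positivity)]

end Candidates

/-! ### The decoder -/

section Decoder

variable {k l m n : ℕ}

/-- The support recovery map: the union of the locations accepted, at threshold `√n`, for one of
the first `n` candidate rows in `grid`. Since the number of candidates grows with `n`, a dense
`grid` makes the map universal, that is, independent of the true rows. -/
def decoder (v s : ℝ≥0) (grid : ℕ → Fin k → Fin l → ℝ) (A : Matrix (Fin n) (Fin m) ℝ)
    (Y : Matrix (Fin n) (Fin l) ℝ) : Set (Fin m) :=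
  {x | ∃ i : Fin n, ∃ S' : Fin k ↪ Fin m, Accepts v s (grid i) √n S' A Y ∧ x ∈ Set.range S'}

lemma measurable_decoder (v s : ℝ≥0) (grid : ℕ → Fin k → Fin l → ℝ) :
    Measurable (Function.uncurry (decoder (m := m) (n := n) v s grid)) := by
  refine measurable_set_iff.2 fun x => measurableSet_setOfPred.1 ?_
  change MeasurableSet {p : Matrix (Fin n) (Fin m) ℝ × Matrix (Fin n) (Fin l) ℝ |
    ∃ i : Fin n, ∃ S' : Fin k ↪ Fin m, Accepts v s (grid i) √n S' p.1 p.2 ∧ x ∈ Set.range S'}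
  simp only [Set.ofPred_exists, Set.ofPred_and]
  exact .iUnion fun i => .iUnion fun S' =>
    (measurableSet_setOf_accepts v s (grid i) √n S').inter (.const _)

lemma not_accepts_or_exists_accepts_of_decoder_ne {v s : ℝ≥0} {grid : ℕ → Fin k → Fin l → ℝ}
    {A : Matrix (Fin n) (Fin m) ℝ} {Y : Matrix (Fin n) (Fin l) ℝ} {S : Fin k ↪ Fin m}
    (h : decoder v s grid A Y ≠ Set.range S) (i₀ : Fin n) :
    ¬ Accepts v s (grid i₀) √n S A Y ∨ ∃ i : Fin n, ∃ S' : Fin k ↪ Fin m,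
      ¬ Set.range S' ⊆ Set.range S ∧ Accepts v s (grid i) √n S' A Y := by
  by_contra! hcon
  refine h (Set.Subset.antisymm ?_ fun x hx => ⟨i₀, S, hcon.1, hx⟩)
  rintro x ⟨i, S', hacc, hx⟩
  by_contra hxS
  exact hcon.2 i S' (fun hsub => hxS (hsub hx)) hacc

lemma rowSupport_signal {W : Matrix (Fin k) (Fin l) ℝ} (hW : ∀ j, W j ≠ 0) (S : Fin k ↪ Fin m) :
    rowSupport (signal W S) = Set.range S := by
  ext x
  simp only [rowSupport, signal, Set.mem_ofPred_eq, Matrix.of_apply, Set.mem_range]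
  constructor
  · rintro ⟨i, hi⟩
    obtain ⟨j, -, hj⟩ := Finset.exists_ne_zero_of_sum_ne_zero hi
    exact ⟨j, by_contra fun h => hj (if_neg (Ne.symm h))⟩
  · rintro ⟨j, rfl⟩
    simpa [S.injective.eq_iff] using Function.ne_iff.1 (hW j)

lemma mul_signal_add_apply (W : Matrix (Fin k) (Fin l) ℝ) (S : Fin k → Fin m)
    (A : Matrix (Fin n) (Fin m) ℝ) (Z : Matrix (Fin n) (Fin l) ℝ) (i : Fin n) :
    (A * signal W S + Z) i = rowMeasurement W (A i ∘ S) (Z i) := by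
  ext q
  simp only [Matrix.add_apply, Matrix.mul_apply, signal, Matrix.of_apply, rowMeasurement,
    Pi.add_apply, Finset.sum_apply, Pi.smul_apply, smul_eq_mul, Finset.mul_sum]
  rw [Finset.sum_comm]
  simp

/-- The bound for the probability of error at fixed locations, when the decoder relies on the
candidate rows `w` and `δ T` is the gap between the mean information density and the acceptance
threshold: a Chebyshev term for the rejection of the true locations, and a union bound for the
acceptance of false ones. -/
noncomputable def errorBound (v s : ℝ≥0) (w W : Fin k → Fin l → ℝ) (δ : Finset (Fin k) → ℝ)
    (n : ℕ) : ℝ :=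
  ∑ T : Finset (Fin k) with T.Nonempty,
    Var[fun x => infoDensity v s w T x.1 (rowMeasurement W x.1 x.2);
      rowLaw (Fin k) (Fin l) v s] / (n * δ T ^ 2) +
  n * ((k + 1) ^ k * Real.exp (-√n))

lemma errorBound_nonneg (v s : ℝ≥0) (w W : Fin k → Fin l → ℝ) (δ : Finset (Fin k) → ℝ) (n : ℕ) :
    0 ≤ errorBound v s w W δ n :=
  add_nonneg (Finset.sum_nonneg fun T _ => div_nonneg (variance_nonneg _ _) (by positivity))
    (by positivity)

lemma measure_pi_decoder_ne_le [Nonempty (Fin m)] {v s : ℝ≥0} (hs : s ≠ 0)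
    (grid : ℕ → Fin k → Fin l → ℝ) (W : Fin k → Fin l → ℝ) (S : Fin k ↪ Fin m) (i₀ : Fin n)
    {δ : Finset (Fin k) → ℝ} (hδ : ∀ T, T.Nonempty → 0 < δ T)
    (hτ : ∀ T : Finset (Fin k), T.Nonempty → T.card * Real.log m + √n ≤
      n * (meanInfoDensity v s W (grid i₀) T - δ T)) :
    (Measure.pi fun _ : Fin n => rowLaw (Fin m) (Fin l) v s) {x | decoder v s grid
        (fun i => (x i).1) (fun i => rowMeasurement W ((x i).1 ∘ S) (x i).2) ≠ Set.range S} ≤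
      ENNReal.ofReal (errorBound v s (grid i₀) W δ n) := by
  have : Nonempty (Fin n) := ⟨i₀⟩
  set P := Measure.pi fun _ : Fin n => rowLaw (Fin m) (Fin l) v s
  set accepted : (Fin k → Fin l → ℝ) → (Fin k ↪ Fin m) →
      (Fin n → (Fin m → ℝ) × (Fin l → ℝ)) → Prop :=
    fun w S' x => Accepts v s w √n S' (fun i => (x i).1)
      fun i => rowMeasurement W ((x i).1 ∘ S) (x i).2
  set misled : Fin n → Set (Fin n → (Fin m → ℝ) × (Fin l → ℝ)) := fun i =>
    {x | ∃ S' : Fin k ↪ Fin m, ¬ Set.range S' ⊆ Set.range S ∧ accepted (grid i) S' x}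
  have hrejected : P {x | ¬ accepted (grid i₀) S x} ≤ _ :=
    measure_pi_not_accepts_le (grid i₀) W S hδ (by simpa using hτ)
  have hmisled (i : Fin n) : P (misled i) ≤ ENNReal.ofReal ((k + 1) ^ k * Real.exp (-√n)) := by
    simpa using measure_pi_exists_accepts_le hs (grid i) W S √n
  calc _ ≤ P ({x | ¬ accepted (grid i₀) S x} ∪ ⋃ i, misled i) := measure_mono fun x hx =>
        (not_accepts_or_exists_accepts_of_decoder_ne hx i₀).imp_right Set.mem_iUnion.2
    _ ≤ P {x | ¬ accepted (grid i₀) S x} + ∑ i, P (misled i) :=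
        (measure_union_le _ _).trans (add_le_add_right (measure_iUnion_fintype_le _ _) _)
    _ ≤ _ + ∑ i, ENNReal.ofReal ((k + 1) ^ k * Real.exp (-√n)) :=
        add_le_add hrejected (Finset.sum_le_sum fun i _ => hmisled i)
    _ = _ := by
        rw [errorBound, ENNReal.ofReal_add (Finset.sum_nonneg fun T _ =>
          div_nonneg (variance_nonneg _ _) (by positivity)) (by positivity),
          Finset.sum_const, Finset.card_univ, Fintype.card_fin, nsmul_eq_mul,
          ENNReal.ofReal_mul (Nat.cast_nonneg n), ENNReal.ofReal_natCast]

lemma prod_gaussianMatrix_decoder_ne_le [Nonempty (Fin m)] {σa σz : ℝ} (hσz : σz ≠ 0)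
    (grid : ℕ → Fin k → Fin l → ℝ) {W : Matrix (Fin k) (Fin l) ℝ} (hW : ∀ j, W j ≠ 0)
    (S : Fin k ↪ Fin m) (i₀ : Fin n) {δ : Finset (Fin k) → ℝ} (hδ : ∀ T, T.Nonempty → 0 < δ T)
    (hτ : ∀ T : Finset (Fin k), T.Nonempty → T.card * Real.log m + √n ≤
      n * (meanInfoDensity (σa ^ 2).toNNReal (σz ^ 2).toNNReal W (grid i₀) T - δ T)) :
    ((gaussianMatrix n m σa).prod (gaussianMatrix n l σz))
      {p | decoder (σa ^ 2).toNNReal (σz ^ 2).toNNReal grid p.1 (p.1 * signal W S + p.2) ≠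
        rowSupport (signal W S)} ≤
      ENNReal.ofReal (errorBound (σa ^ 2).toNNReal (σz ^ 2).toNNReal (grid i₀) W δ n) := by
  have hs : (σz ^ 2).toNNReal ≠ 0 := (Real.toNNReal_pos.2 (by positivity)).ne'
  rw [rowSupport_signal hW]
  have hrows := (measurePreserving_arrowProdEquivProdArrow (Fin m → ℝ) (Fin l → ℝ) (Fin n)
    (fun _ => Measure.pi fun _ => gaussianReal 0 (σa ^ 2).toNNReal)
    (fun _ => Measure.pi fun _ => gaussianReal 0 (σz ^ 2).toNNReal)).measure_preimage_equiv
      {p | decoder (σa ^ 2).toNNReal (σz ^ 2).toNNReal grid p.1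
        (fun i => rowMeasurement W (p.1 i ∘ S) (p.2 i)) ≠ Set.range S}
  have hY (p : Matrix (Fin n) (Fin m) ℝ × Matrix (Fin n) (Fin l) ℝ) :
      p.1 * signal W S + p.2 = fun i => rowMeasurement W (p.1 i ∘ S) (p.2 i) :=
    funext fun i => mul_signal_add_apply W S p.1 p.2 i
  simp only [hY]
  exact hrows.symm.trans_le (measure_pi_decoder_ne_le hs grid W S i₀ hδ hτ)

end Decoder

/-! ### Averaging over the locations -/

section Averaging

variable {k l m n : ℕ}

lemma prod_le_measure_univ_mul {α Ω : Type*} [Countable α] [MeasurableSpace α]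
    [MeasurableSingletonClass α] [MeasurableSpace Ω] (ν : Measure α) (P : Measure Ω) [SFinite P]
    {B : Set (α × Ω)} {b : ℝ≥0∞} (hB : ∀ x, ν {x} ≠ 0 → P {ω | (x, ω) ∈ B} ≤ b) :
    ν.prod P B ≤ ν Set.univ * b := by
  calc ν.prod P B ≤ ν.prod P (⋃ x, {x} ×ˢ {ω | (x, ω) ∈ B}) :=
        measure_mono fun ⟨x, ω⟩ h => by simpa using h
    _ ≤ ∑' x, ν.prod P ({x} ×ˢ {ω | (x, ω) ∈ B}) := measure_iUnion_le _
    _ ≤ ∑' x, b * ν {x} := ENNReal.tsum_le_tsum fun x => by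
        rw [Measure.prod_prod, mul_comm]
        rcases eq_or_ne (ν {x}) 0 with hx | hx
        · simp [hx]
        · gcongr
          exact hB x hx
    _ = ν Set.univ * b := by rw [← lintegral_countable', lintegral_const, mul_comm]

instance : IsZeroOrProbabilityMeasure (locationLaw k m) :=
  inferInstanceAs (IsZeroOrProbabilityMeasure (cond _ _))

lemma injective_of_locationLaw_ne_zero {S : Fin k → Fin m} (hS : locationLaw k m {S} ≠ 0) :
    Function.Injective S := by
  contrapose! hS
  rw [locationLaw, uniformOn, cond_apply (Set.toFinite _).measurableSet,
    Set.inter_singleton_eq_empty.2 hS, measure_empty, mul_zero]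

instance (p q : ℕ) (σ : ℝ) : IsProbabilityMeasure (gaussianMatrix p q σ) :=
  inferInstanceAs (IsProbabilityMeasure (Measure.pi fun _ : Fin p =>
    Measure.pi fun _ : Fin q => gaussianReal 0 (σ ^ 2).toNNReal))

lemma errorProb_decoder_le (hk : 0 < k) {σa σz : ℝ} (hσz : σz ≠ 0)
    (grid : ℕ → Fin k → Fin l → ℝ) {W : Matrix (Fin k) (Fin l) ℝ} (hW : ∀ j, W j ≠ 0) (i₀ : Fin n)
    {δ : Finset (Fin k) → ℝ} (hδ : ∀ T, T.Nonempty → 0 < δ T)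
    (hτ : ∀ T : Finset (Fin k), T.Nonempty → T.card * Real.log m + √n ≤
      n * (meanInfoDensity (σa ^ 2).toNNReal (σz ^ 2).toNNReal W (grid i₀) T - δ T)) :
    errorProb (m := m) (n := n) σa σz W
        (decoder (σa ^ 2).toNNReal (σz ^ 2).toNNReal grid) ≤
      errorBound (σa ^ 2).toNNReal (σz ^ 2).toNNReal (grid i₀) W δ n := by
  refine ENNReal.toReal_le_of_le_ofReal (errorBound_nonneg _ _ _ _ _ _) ?_
  refine (prod_le_measure_univ_mul (locationLaw k m) _ fun S hS => ?_).trans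
    (mul_le_of_le_one_left' prob_le_one)
  have : Nonempty (Fin m) := ⟨S ⟨0, hk⟩⟩
  exact prod_gaussianMatrix_decoder_ne_le hσz grid hW
    ⟨S, injective_of_locationLaw_ne_zero hS⟩ i₀ hδ hτ

end Averaging

/-! ### Asymptotics -/

section Asymptotics

variable {k l : ℕ}

lemma tendsto_errorBound (v s : ℝ≥0) (w W : Fin k → Fin l → ℝ) (δ : Finset (Fin k) → ℝ) :
    Tendsto (errorBound v s w W δ) atTop (𝓝 0) := by
  have hvar (V d : ℝ) : Tendsto (fun n : ℕ => V / (n * d ^ 2)) atTop (𝓝 0) :=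
    (tendsto_const_div_atTop_nhds_zero_nat (V / d ^ 2)).congr fun n => by rw [div_div, mul_comm]
  have hexp : Tendsto (fun n : ℕ => (n : ℝ) * ((k + 1) ^ k * Real.exp (-√n))) atTop (𝓝 0) := by
    have h := ((Real.tendsto_pow_mul_exp_neg_atTop_nhds_zero 2).comp
      (Real.tendsto_sqrt_atTop.comp tendsto_natCast_atTop_atTop)).const_mul ((k + 1 : ℝ) ^ k)
    rw [mul_zero] at h
    refine h.congr fun n => ?_
    simp only [Function.comp_apply, Real.sq_sqrt (Nat.cast_nonneg n)]
    ring
  have h := (tendsto_finsetSum ({T | T.Nonempty} : Finset (Finset (Fin k))) fun T _ =>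
    hvar Var[fun x => infoDensity v s w T x.1 (rowMeasurement W x.1 x.2);
      rowLaw (Fin k) (Fin l) v s] (δ T)).add hexp
  rwa [Finset.sum_const_zero, add_zero] at h

lemma sum_vecMulVec_eq_transpose_mul_submatrix (W : Matrix (Fin k) (Fin l) ℝ)
    (T : Finset (Fin k)) :
    ∑ j ∈ T, Matrix.vecMulVec (W j) (W j) =
      (W.submatrix (fun i : T => (i : Fin k)) id).transpose *
        W.submatrix (fun i : T => (i : Fin k)) id := by
  ext p q
  rw [Matrix.sum_apply, Matrix.mul_apply, ← Finset.sum_coe_sort]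
  rfl

lemma card_mul_threshold_le (σa σz : ℝ) (W : Matrix (Fin k) (Fin l) ℝ) {T : Finset (Fin k)}
    (hT : T.Nonempty) :
    T.card * threshold σa σz W ≤
      Real.log (1 + (σa ^ 2 / σz ^ 2) • ∑ j ∈ T, Matrix.vecMulVec (W j) (W j)).det / 2 := by
  have hcard : (0 : ℝ) < T.card := Nat.cast_pos.2 hT.card_pos
  rw [sum_vecMulVec_eq_transpose_mul_submatrix]
  refine (mul_le_mul_of_nonneg_left (ciInf_le (Set.finite_range _).bddBelow
    (⟨T, hT⟩ : {T : Finset (Fin k) // T.Nonempty})) hcard.le).trans_eq ?_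
  field_simp

lemma ne_zero_of_threshold_pos {σa σz : ℝ} {W : Matrix (Fin k) (Fin l) ℝ}
    (hpos : 0 < threshold σa σz W) (j : Fin k) : W j ≠ 0 := by
  intro hj
  have h := card_mul_threshold_le σa σz W (Finset.singleton_nonempty j)
  have hle : threshold σa σz W ≤ 0 := by simpa [hj] using h
  exact hpos.not_ge hle

lemma exists_forall_card_mul_lt_meanInfoDensity {σa σz : ℝ} (hσz : σz ≠ 0)
    {grid : ℕ → Fin k → Fin l → ℝ} (hgrid : DenseRange grid) (W : Matrix (Fin k) (Fin l) ℝ)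
    {R : ℝ} (hR : R < threshold σa σz W) :
    ∃ i₀, ∀ T : Finset (Fin k), T.Nonempty →
      T.card * R < meanInfoDensity (σa ^ 2).toNNReal (σz ^ 2).toNNReal W (grid i₀) T := by
  have hs : (σz ^ 2).toNNReal ≠ 0 := (Real.toNNReal_pos.2 (by positivity)).ne'
  have hopen : IsOpen {w : Fin k → Fin l → ℝ | ∀ T : Finset (Fin k), T.Nonempty →
      T.card * R < meanInfoDensity (σa ^ 2).toNNReal (σz ^ 2).toNNReal W w T} := by
    simp only [Set.ofPred_forall]
    exact isOpen_iInter_of_finite fun T => isOpen_iInter_of_finite fun _ =>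
      isOpen_lt continuous_const (continuous_meanInfoDensity hs W T)
  refine hgrid.exists_mem_open hopen ⟨W, fun T hT => ?_⟩
  have : (0 : ℝ) < T.card := Nat.cast_pos.2 hT.card_pos
  calc T.card * R < T.card * threshold σa σz W := by gcongr
    _ ≤ _ := card_mul_threshold_le σa σz W hT
    _ = _ := by
      have h := meanInfoDensity_self (v := (σa ^ 2).toNNReal) hs W T
      rw [NNReal.coe_div, Real.coe_toNNReal _ (sq_nonneg _),
        Real.coe_toNNReal _ (sq_nonneg _)] at h
      exact h.symm

lemma eventually_sqrt_le_mul {δ : ℝ} (hδ : 0 < δ) : ∀ᶠ n : ℕ in atTop, √n ≤ n * δ := by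
  have hsqrt := Real.tendsto_sqrt_atTop.comp (tendsto_natCast_atTop_atTop (R := ℝ))
  filter_upwards [hsqrt.eventually_ge_atTop δ⁻¹] with n hn
  calc √n ≤ √n * (√n * δ) :=
        le_mul_of_one_le_right (Real.sqrt_nonneg _) ((inv_le_iff_one_le_mul₀ hδ).1 hn)
    _ = n * δ := by rw [← mul_assoc, Real.mul_self_sqrt (Nat.cast_nonneg _)]

variable {n : ℕ → ℕ} {R : ℝ}

lemma eventually_log_le_mul (hn : ∀ᶠ m in atTop, 0 < n m)
    (hR : limsup (fun m : ℕ => ((Real.log m / n m : ℝ) : EReal)) atTop < R) :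
    ∀ᶠ m : ℕ in atTop, Real.log m ≤ R * n m := by
  filter_upwards [eventually_lt_of_limsup_lt hR, hn] with m hm hnm
  exact ((div_lt_iff₀ (Nat.cast_pos.2 hnm)).1 (EReal.coe_lt_coe_iff.1 hm)).le

lemma tendsto_log_natCast_atTop : Tendsto (fun m : ℕ => Real.log m) atTop atTop :=
  Real.tendsto_log_atTop.comp tendsto_natCast_atTop_atTop

lemma pos_of_eventually_log_le_mul (h : ∀ᶠ m : ℕ in atTop, Real.log m ≤ R * n m) : 0 < R := by
  obtain ⟨m, hle, hpos⟩ := (h.and (tendsto_log_natCast_atTop.eventually_gt_atTop 0)).exists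
  exact pos_of_mul_pos_left (hpos.trans_le hle) (Nat.cast_nonneg _)

lemma tendsto_atTop_of_eventually_log_le_mul (h : ∀ᶠ m : ℕ in atTop, Real.log m ≤ R * n m) :
    Tendsto n atTop atTop := by
  have hR := pos_of_eventually_log_le_mul h
  rw [← tendsto_natCast_atTop_iff (R := ℝ)]
  refine tendsto_atTop_mono' _ ?_ (tendsto_log_natCast_atTop.atTop_div_const hR)
  filter_upwards [h] with m hm
  rwa [div_le_iff₀' hR]

lemma tendsto_errorProb_decoder (hk : 0 < k) {σa σz : ℝ} (hσz : σz ≠ 0)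
    {grid : ℕ → Fin k → Fin l → ℝ} (hgrid : DenseRange grid) (hn : ∀ᶠ m in atTop, 0 < n m)
    {W : Matrix (Fin k) (Fin l) ℝ}
    (hrate : limsup (fun m : ℕ => ((Real.log m / n m : ℝ) : EReal)) atTop
      < (threshold σa σz W : EReal)) :
    Tendsto (fun m => errorProb (m := m) (n := n m) σa σz W
      (decoder (σa ^ 2).toNNReal (σz ^ 2).toNNReal grid)) atTop (𝓝 0) := by
  obtain ⟨R, hlimsup, hR⟩ := EReal.lt_iff_exists_real_btwn.1 hrate
  have hR : R < threshold σa σz W := EReal.coe_lt_coe_iff.1 hR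
  have hlog := eventually_log_le_mul hn hlimsup
  have hntop := tendsto_atTop_of_eventually_log_le_mul hlog
  have hW := ne_zero_of_threshold_pos ((pos_of_eventually_log_le_mul hlog).trans hR)
  obtain ⟨i₀, hi₀⟩ := exists_forall_card_mul_lt_meanInfoDensity hσz hgrid W hR
  set J := meanInfoDensity (σa ^ 2).toNNReal (σz ^ 2).toNNReal W (grid i₀)
  set δ : Finset (Fin k) → ℝ := fun T => (J T - T.card * R) / 2 with hδ_def
  have hδ (T : Finset (Fin k)) (hT : T.Nonempty) : 0 < δ T := half_pos (sub_pos.2 (hi₀ T hT))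
  have hslack : ∀ᶠ m in atTop, ∀ T : Finset (Fin k), T.Nonempty → √(n m) ≤ n m * δ T :=
    eventually_all.2 fun T => eventually_imp_distrib_left.2 fun hT =>
      hntop.eventually (eventually_sqrt_le_mul (hδ T hT))
  refine squeeze_zero' (.of_forall fun m => measureReal_nonneg) ?_
    ((tendsto_errorBound (σa ^ 2).toNNReal (σz ^ 2).toNNReal (grid i₀) W δ).comp hntop)
  filter_upwards [hlog, hslack, hntop.eventually_gt_atTop i₀] with m hlog hslack hi
  refine errorProb_decoder_le hk hσz grid hW ⟨i₀, hi⟩ hδ fun T hT => ?_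
  calc T.card * Real.log m + √(n m) ≤ T.card * (R * n m) + n m * δ T :=
        add_le_add (by gcongr) (hslack T hT)
    _ = n m * (J T - δ T) := by rw [hδ_def]; ring

end Asymptotics

end SupportRecovery

theorem theorem1_general (k l : ℕ) (hk : 0 < k) (σa σz : ℝ) (hσz : σz ≠ 0) (n : ℕ → ℕ)
    (hn : ∀ᶠ m in atTop, 0 < n m) :
    ∃ d : (m : ℕ) → Matrix (Fin (n m)) (Fin m) ℝ → Matrix (Fin (n m)) (Fin l) ℝ → Set (Fin m),
      (∀ m, Measurable (Function.uncurry (d m))) ∧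
      ∀ W : Matrix (Fin k) (Fin l) ℝ,
        limsup (fun m : ℕ => ((Real.log m / n m : ℝ) : EReal)) atTop
          < (SupportRecovery.threshold σa σz W : EReal) →
        Tendsto (fun m => SupportRecovery.errorProb σa σz W (d m)) atTop (𝓝 0) :=
  ⟨fun _ => SupportRecovery.decoder _ _ (TopologicalSpace.denseSeq (Fin k → Fin l → ℝ)),
    fun _ => SupportRecovery.measurable_decoder _ _ _, fun _ hrate =>
      SupportRecovery.tendsto_errorProb_decoder hk hσz
        (TopologicalSpace.denseRange_denseSeq _) hn hrate⟩

theorem theorem1 (k l : ℕ) (hk : 0 < k) (hl : 0 < l) (σa σz : ℝ) (hσa : 0 < σa) (hσz : 0 < σz)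
    (n : ℕ → ℕ) (hn : ∀ m, k ≤ m → 0 < n m) :
    ∃ d : (m : ℕ) → Matrix (Fin (n m)) (Fin m) ℝ → Matrix (Fin (n m)) (Fin l) ℝ → Set (Fin m),
      (∀ m, Measurable (Function.uncurry (d m))) ∧
      ∀ W : Matrix (Fin k) (Fin l) ℝ, (∀ i j, W i j ≠ 0) →
        limsup (fun m : ℕ => ((Real.log m / n m : ℝ) : EReal)) atTop
          < (SupportRecovery.threshold σa σz W : EReal) →
        Tendsto (fun m => SupportRecovery.errorProb σa σz W (d m)) atTop (𝓝 0) := by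
  obtain ⟨d, hd, h⟩ := theorem1_general k l hk σa σz hσz.ne' n ((eventually_ge_atTop k).mono hn)
  exact ⟨d, hd, fun W _ => h W⟩
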